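/- A \emph{real simplicial tree} is a simplicial tree $X$ (the points of the edges belong to $X$) endowed with a distance $d$ for which the image of every injective path is isometric to a segment of $\mathbb{R}$. Let $\mathrm{Isom}(X)$ be the group of bijective isometries of $X$ that send vertices to vertices and edges to edges, with the group topology for which the pointwise fixators of the compact subsets of $X$ form a basis of neighbourhoods of the identity. Let $X$ be a real simplicial tree, bipartite with (finite) valences $n_1\geq 2$ and $n_2\geq 2$ where $(n_1,n_2)\neq(2,2)$ (the vertices are of two types, adjacent vertices have different types, and each vertex of the $i$-th type has exactly $n_i$ neighbours), all of whose edges have the same length. Let $\Gamma_0$ be a discrete torsion-free subgroup of $\mathrm{Isom}(X)$ such that the quotient graph $\Gamma_0\backslash X$ is finite, and let $x_0,x_0'\in X$. A group homomorphism $\rho:\Gamma_0\to\mathrm{Isom}(X)$ is called \emph{admissible} if for every $R>0$ one has $$d(x_0',\rho(\gamma)\cdot x_0')\ \leq\ d(x_0,\gamma\cdot x_0)-R$$ for all but finitely many $\gamma\in\Gamma_0$ (this does not depend on the choice of $x_0,x_0'$). Then there is no admissible group homomorphism $\rho:\Gamma_0\to\mathrm{Isom}(X)$ that is injective with discrete image.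 -/

import Mathlib

open scoped Pointwise

/-- A subset of a metric space is isometric to a compact segment of the real line. -/
def IsRealSegment {X : Type*} [MetricSpace X] (s : Set X) : Prop :=
  ∃ l : ℝ, 0 ≤ l ∧ Nonempty (s ≃ᵢ Set.Icc (0 : ℝ) l)

/-- The metric segment `[u, v]`: the points lying between `u` and `v`. -/
def metricSegment {X : Type*} [MetricSpace X] (u v : X) : Set X :=
  {x | dist u x + dist x v = dist u v}

/-- The structure of a real simplicial tree on a metric space `X`: a simplicial tree whose
underlying space, edges included, is `X`, and whose distance is such that the image of every
injective path is isometric to a real segment. Different edges may have different lengths. -/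
structure SimplicialRealTree (X : Type*) [MetricSpace X] where
  /-- the set of vertices -/
  vertices : Set X
  /-- the combinatorial graph -/
  graph : SimpleGraph vertices
  isTree : graph.IsTree
  /-- a (closed) edge is the segment between two adjacent vertices -/
  edge_isRealSegment : ∀ u v : vertices, graph.Adj u v → IsRealSegment (metricSegment (u : X) v)
  /-- `X` is the union of its vertices and its edges -/
  cover : ∀ x : X, x ∈ vertices ∨ ∃ u v : vertices, graph.Adj u v ∧ x ∈ metricSegment (u : X) v
  /-- the only vertices on an edge are its two extremities -/
  vertex_of_mem_edge : ∀ u v w : vertices, graph.Adj u v →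
    (w : X) ∈ metricSegment (u : X) v → w = u ∨ w = v
  /-- two distinct edges meet only at vertices -/
  mem_vertices_of_mem_edges : ∀ u v u' v' : vertices, graph.Adj u v → graph.Adj u' v' →
    s(u, v) ≠ s(u', v') → ∀ x : X, x ∈ metricSegment (u : X) v → x ∈ metricSegment (u' : X) v' →
      x ∈ vertices
  /-- the image of every injective path is isometric to a real segment -/
  injective_path : ∀ c : unitInterval → X, Continuous c → Function.Injective c →
    IsRealSegment (Set.range c)

namespace SimplicialRealTree

variable {X : Type*} [MetricSpace X] (T : SimplicialRealTree X)

/-- The set of closed edges, as subsets of `X`. -/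
def edges : Set (Set X) :=
  {e | ∃ u v : T.vertices, T.graph.Adj u v ∧ e = metricSegment (u : X) v}

/-- The tree is bipartite with valences `n₁` and `n₂`: its vertices are of two types, adjacent
vertices have different types, each vertex of the first type has exactly `n₁` neighbours, and each
vertex of the second type has exactly `n₂` neighbours. -/
def IsBipartiteOfValences (n₁ n₂ : ℕ) : Prop :=
  ∃ first : Set T.vertices,
    (∀ u v : T.vertices, T.graph.Adj u v → (u ∈ first ↔ v ∉ first)) ∧
    (∀ v : T.vertices, v ∈ first → (T.graph.neighborSet v).encard = n₁) ∧
    (∀ v : T.vertices, v ∉ first → (T.graph.neighborSet v).encard = n₂)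

/-- All the edges have the same length. -/
def EdgesOfEqualLength : Prop :=
  ∃ L : ℝ, ∀ u v : T.vertices, T.graph.Adj u v → dist (u : X) v = L

/-- `Isom(X)`: the group of bijective isometries of `X` that send vertices to vertices and edges
to edges. -/
def isom : Subgroup (X ≃ᵢ X) where
  carrier := {g | (∀ x : X, g x ∈ T.vertices ↔ x ∈ T.vertices) ∧
    ∀ e : Set X, g '' e ∈ T.edges ↔ e ∈ T.edges}
  one_mem' := by
    refine ⟨fun x => Iff.rfl, fun e => ?_⟩
    have : ((1 : X ≃ᵢ X) : X → X) = id := rfl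
    rw [this, Set.image_id]
  mul_mem' := by
    rintro a b ⟨ha, ha'⟩ ⟨hb, hb'⟩
    refine ⟨fun x => (ha (b x)).trans (hb x), fun e => ?_⟩
    have : ((a * b : X ≃ᵢ X) : X → X) = a ∘ b := rfl
    rw [this, Set.image_comp]
    exact (ha' _).trans (hb' e)
  inv_mem' := by
    rintro a ⟨ha, ha'⟩
    refine ⟨fun x => ?_, fun e => ?_⟩
    · rw [← ha, IsometryEquiv.apply_inv_self]
    · rw [← ha', ← Set.image_comp]
      have : (a : X → X) ∘ ((a⁻¹ : X ≃ᵢ X) : X → X) = id := by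
        funext x
        exact IsometryEquiv.apply_inv_self a x
      rw [this, Set.image_id]

instance : MulAction T.isom X where
  smul g x := (g : X ≃ᵢ X) x
  one_smul _ := rfl
  mul_smul _ _ _ := rfl

/-- The pointwise fixator of a subset `K` of `X` in `Isom(X)`. -/
def fixator (K : Set X) : Set T.isom := {g | ∀ x ∈ K, g • x = x}

/-- The fixators of the compact subsets of `X` form a basis of neighbourhoods of the identity for a
group topology. -/
abbrev isomBasis : GroupFilterBasis T.isom where
  sets := {U | ∃ K : Set X, IsCompact K ∧ U = T.fixator K}
  nonempty := ⟨_, ∅, isCompact_empty, rfl⟩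
  inter_sets := by
    rintro _ _ ⟨K, hK, rfl⟩ ⟨K', hK', rfl⟩
    exact ⟨_, ⟨K ∪ K', hK.union hK', rfl⟩,
      fun g hg => ⟨fun x hx => hg x (Or.inl hx), fun x hx => hg x (Or.inr hx)⟩⟩
  one' := by
    rintro _ ⟨K, -, rfl⟩ x -
    exact one_smul _ x
  mul' := by
    rintro _ ⟨K, hK, rfl⟩
    refine ⟨_, ⟨K, hK, rfl⟩, ?_⟩
    rintro _ ⟨a, ha, b, hb, rfl⟩ x hx
    change (a * b) • x = x
    rw [mul_smul, hb x hx, ha x hx]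
  inv' := by
    rintro _ ⟨K, hK, rfl⟩
    refine ⟨_, ⟨K, hK, rfl⟩, fun a ha x hx => ?_⟩
    rw [inv_smul_eq_iff, ha x hx]
  conj' := by
    rintro g _ ⟨K, hK, rfl⟩
    refine ⟨_, ⟨(fun x : X => g⁻¹ • x) '' K,
      hK.image (IsometryEquiv.continuous ((g⁻¹ : T.isom) : X ≃ᵢ X)), rfl⟩, fun a ha x hx => ?_⟩
    change (g * a * g⁻¹) • x = x
    rw [mul_smul, mul_smul, ha _ ⟨x, hx, rfl⟩, smul_inv_smul]

/-- The topology of `Isom(X)`: the fixators of the compact subsets of `X` form a basis of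
neighbourhoods of the identity. -/
instance : TopologicalSpace T.isom := T.isomBasis.topology

/-- The quotient graph `Γ\X` is finite: there are finitely many orbits of vertices and finitely
many orbits of edges. -/
def FiniteQuotient (Γ : Subgroup T.isom) : Prop :=
  ((fun x : X => MulAction.orbit Γ x) '' T.vertices).Finite ∧
  ((fun e : Set X => MulAction.orbit Γ e) '' T.edges).Finite

/-- A homomorphism `ρ : Γ → Isom(X')`, where `Γ` is a subgroup of `Isom(X)`, is admissible with
respect to base points `x₀` and `x₀'` if for every `R > 0` one has
`d(x₀', ρ(γ) x₀') ≤ d(x₀, γ x₀) - R` for all but finitely many `γ` in `Γ`. -/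
def Admissible {X' : Type*} [MetricSpace X'] (T' : SimplicialRealTree X') (Γ : Subgroup T.isom)
    (x₀ : X) (x₀' : X') (ρ : Γ →* T'.isom) : Prop :=
  ∀ R : ℝ, 0 < R → ∀ᶠ γ : Γ in Filter.cofinite,
    dist x₀' (ρ γ • x₀') ≤ dist x₀ ((γ : T.isom) • x₀) - R

end SimplicialRealTree

/-! The proof is a growth comparison. Let `b n` count the vertices within `n * L` of a vertex `v`.
As some vertex of each edge has valence at least 3 and no valence is below 2, `b` at least doubles
every two steps (`two_mul_ncard_ball_le`). Finiteness of the quotient bounds `b (n + 2k)` by a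
constant `m` times the number of `γ` moving `v` by at most `(n + 2k) * L + M`
(`exists_ncard_vertexBall_le`). Admissibility says that, outside a finite set `E` independent of
`n`, such a `γ` has `ρ γ` moving `v` by at most `n * L`. Since `ρ` is injective with discrete image,
the stabiliser of `v` through `ρ` has finite order `C`, so there are at most `b n * C` of these
(`ncard_dist_smul_le`). Hence `2 ^ k * b n ≤ (|E| + b n * C) * m`; once `2 ^ k > C * m`, this bounds
`b`, which contradicts its exponential growth. -/

/-! ### Growth of balls in a combinatorial tree. -/

namespace SimpleGraph

variable {V : Type*} {G : SimpleGraph V}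

/-- In a tree, a vertex has at most one neighbour closer to the root. -/
theorem IsTree.parent_unique (hG : G.IsTree) {r a b w : V} (ha : G.Adj a w) (hb : G.Adj b w)
    (hda : G.dist r w = G.dist r a + 1) (hdb : G.dist r w = G.dist r b + 1) : a = b := by
  obtain ⟨p, hp⟩ := hG.1.exists_walk_length_eq_dist r a
  obtain ⟨q, hq⟩ := hG.1.exists_walk_length_eq_dist r b
  have hp' : (p.concat ha).IsPath := Walk.isPath_of_length_eq_dist _ (by simp; omega)
  have hq' : (q.concat hb).IsPath := Walk.isPath_of_length_eq_dist _ (by simp; omega)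
  have := hG.2.subsingleton_path r w
  have h := Subsingleton.elim (α := G.Path r w) ⟨_, hp'⟩ ⟨_, hq'⟩
  have h' : p.concat ha = q.concat hb := congrArg Subtype.val h
  exact (Walk.concat_inj h').1

/-- The neighbours of `u` which are farther from the root `r`. -/
def children (G : SimpleGraph V) (r u : V) : Set V := {w | G.Adj u w ∧ G.dist r w = G.dist r u + 1}

theorem IsTree.encard_neighborSet_le_children (hG : G.IsTree) (r u : V) :
    (G.neighborSet u).encard ≤ (G.children r u).encard + 1 := by
  have hsub : (G.neighborSet u) ⊆
      G.children r u ∪ {w | G.Adj w u ∧ G.dist r u = G.dist r w + 1} := by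
    intro w hw
    rcases hG.dist_eq_dist_add_one_of_adj r hw with h | h
    · exact Or.inr ⟨G.adj_symm hw, h⟩
    · exact Or.inl ⟨hw, h⟩
  refine (Set.encard_le_encard hsub).trans ((Set.encard_union_le _ _).trans ?_)
  gcongr
  rw [Set.encard_le_one_iff_subsingleton]
  rintro a ⟨ha, hda⟩ b ⟨hb, hdb⟩
  exact hG.parent_unique ha hb hda hdb

theorem IsTree.children_nontrivial (hG : G.IsTree) {r u : V} (h : 3 ≤ (G.neighborSet u).encard) :
    (G.children r u).Nontrivial := by
  rw [← Set.one_lt_encard_iff_nontrivial]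
  by_contra! h'
  have := h.trans ((hG.encard_neighborSet_le_children r u).trans (add_le_add_left h' 1))
  norm_num at this

theorem IsTree.children_nonempty (hG : G.IsTree) {r u : V} (h : 2 ≤ (G.neighborSet u).encard) :
    (G.children r u).Nonempty := by
  rw [Set.nonempty_iff_ne_empty]
  intro h'
  have := h.trans (hG.encard_neighborSet_le_children r u)
  rw [h'] at this
  norm_num at this

/-- Two generations are needed because one type may have valence 2: branching then occurs only at
`u` or only at its children. -/
theorem IsTree.exists_two_grandchildren (hG : G.IsTree) (r u : V)
    (h2 : ∀ v, 2 ≤ (G.neighborSet v).encard)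
    (h3 : 3 ≤ (G.neighborSet u).encard ∨ ∀ w, G.Adj u w → 3 ≤ (G.neighborSet w).encard) :
    ∃ w₁ w₂, w₁ ≠ w₂ ∧ (∃ c ∈ G.children r u, w₁ ∈ G.children r c) ∧
      ∃ c ∈ G.children r u, w₂ ∈ G.children r c := by
  rcases h3 with h3 | h3
  · obtain ⟨a, ha, b, hb, hab⟩ := hG.children_nontrivial (r := r) h3
    obtain ⟨x, hx⟩ := hG.children_nonempty (r := r) (h2 a)
    obtain ⟨y, hy⟩ := hG.children_nonempty (r := r) (h2 b)
    refine ⟨x, y, ?_, ⟨a, ha, hx⟩, b, hb, hy⟩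
    rintro rfl
    exact hab (hG.parent_unique hx.1 hy.1 hx.2 hy.2)
  · obtain ⟨a, ha⟩ := hG.children_nonempty (r := r) (h2 u)
    obtain ⟨x, hx, y, hy, hxy⟩ := hG.children_nontrivial (r := r) (h3 a ha.1)
    exact ⟨x, y, hxy, ⟨a, ha, hx⟩, a, ha, hy⟩

theorem IsTree.grandparent_unique (hG : G.IsTree) {r u u' c c' w : V}
    (hc : c ∈ G.children r u) (hw : w ∈ G.children r c)
    (hc' : c' ∈ G.children r u') (hw' : w ∈ G.children r c') : u = u' := by
  obtain rfl := hG.parent_unique hw.1 hw'.1 hw.2 hw'.2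
  exact hG.parent_unique hc.1 hc'.1 hc.2 hc'.2

theorem Connected.finite_dist_le (hG : G.Connected) (hf : ∀ v, (G.neighborSet v).Finite) (r : V)
    (n : ℕ) : {u | G.dist r u ≤ n}.Finite := by
  induction n with
  | zero =>
    refine (Set.finite_singleton r).subset fun u hu => ?_
    exact (hG.dist_eq_zero_iff.1 (Nat.le_zero.1 hu)).symm
  | succ n ih =>
    refine (ih.union (ih.biUnion fun u _ => hf u)).subset fun w hw => ?_
    by_cases h : G.dist r w ≤ n
    · exact Or.inl h
    · right
      obtain ⟨p, hp⟩ := hG.exists_walk_length_eq_dist w r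
      rw [dist_comm] at hp
      cases p with
      | nil => simp at h
      | cons hadj q =>
        rename_i v
        simp only [Walk.length_cons] at hp
        have h1 := G.dist_le q
        rw [dist_comm] at h1
        have h2 : G.dist r w ≤ n + 1 := hw
        exact Set.mem_biUnion (x := v) (show G.dist r v ≤ n by omega) (G.adj_symm hadj)

/-- Balls at least double when the radius increases by `2`. -/
theorem IsTree.two_mul_ncard_ball_le (hG : G.IsTree) (hf : ∀ v, (G.neighborSet v).Finite)
    (h2 : ∀ v, 2 ≤ (G.neighborSet v).encard)
    (h3 : ∀ u, 3 ≤ (G.neighborSet u).encard ∨ ∀ w, G.Adj u w → 3 ≤ (G.neighborSet w).encard)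
    (r : V) (n : ℕ) :
    2 * {u | G.dist r u ≤ n}.ncard ≤ {u | G.dist r u ≤ n + 2}.ncard := by
  choose f g hne hf' hg' using fun u => hG.exists_two_grandchildren r u h2 (h3 u)
  have hfinj : Function.Injective f := fun u u' h => by
    obtain ⟨c, hc, hw⟩ := hf' u
    obtain ⟨c', hc', hw'⟩ := hf' u'
    exact hG.grandparent_unique hc (h ▸ hw) hc' hw'
  have hginj : Function.Injective g := fun u u' h => by
    obtain ⟨c, hc, hw⟩ := hg' u
    obtain ⟨c', hc', hw'⟩ := hg' u'
    exact hG.grandparent_unique hc (h ▸ hw) hc' hw'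
  have hfin := hG.1.finite_dist_le hf r n
  have hdisj : Disjoint (f '' {u | G.dist r u ≤ n}) (g '' {u | G.dist r u ≤ n}) := by
    rw [Set.disjoint_left]
    rintro _ ⟨u, -, rfl⟩ ⟨u', -, h⟩
    obtain ⟨c, hc, hw⟩ := hf' u
    obtain ⟨c', hc', hw'⟩ := hg' u'
    obtain rfl := hG.grandparent_unique hc (h ▸ hw) hc' hw'
    exact hne _ h.symm
  have hsub : f '' {u | G.dist r u ≤ n} ∪ g '' {u | G.dist r u ≤ n} ⊆
      {u | G.dist r u ≤ n + 2} := by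
    rintro _ (⟨u, hu, rfl⟩ | ⟨u, hu, rfl⟩)
    · obtain ⟨c, hc, hw⟩ := hf' u
      have := hc.2; have := hw.2
      simp only [Set.mem_ofPred_eq] at hu ⊢
      omega
    · obtain ⟨c, hc, hw⟩ := hg' u
      have := hc.2; have := hw.2
      simp only [Set.mem_ofPred_eq] at hu ⊢
      omega
  have := Set.ncard_le_ncard hsub (hG.1.finite_dist_le hf r (n + 2))
  rw [Set.ncard_union_eq hdisj (hfin.image _) (hfin.image _),
    Set.ncard_image_of_injective _ hfinj, Set.ncard_image_of_injective _ hginj] at this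
  omega

end SimpleGraph

/-! ### Real segments and injective paths. -/

section Segments

variable {X : Type*} [MetricSpace X]

theorem left_mem_metricSegment (u v : X) : u ∈ metricSegment u v := by simp [metricSegment]

theorem right_mem_metricSegment (u v : X) : v ∈ metricSegment u v := by simp [metricSegment]

/-- In real coordinates, distinct points equidistant from `u` and from `v` would both have `u` and
`v` as midpoint, which forces `u = v` and a one-point segment. -/
theorem IsRealSegment.eq_of_dist_eq {u v y z : X} (h : IsRealSegment (metricSegment u v))
    (hy : y ∈ metricSegment u v) (hz : z ∈ metricSegment u v) (hyz : dist u y = dist u z) :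
    y = z := by
  obtain ⟨l, -, ⟨e⟩⟩ := h
  have hyv : dist y v = dist z v := by
    have h1 : dist u y + dist y v = dist u v := hy
    have h2 : dist u z + dist z v = dist u v := hz
    linarith
  let U : metricSegment u v := ⟨u, left_mem_metricSegment u v⟩
  let W : metricSegment u v := ⟨v, right_mem_metricSegment u v⟩
  let Y : metricSegment u v := ⟨y, hy⟩
  let Z : metricSegment u v := ⟨z, hz⟩
  have h1 : dist (e U) (e Y) = dist (e U) (e Z) := by
    rw [e.dist_eq, e.dist_eq]; exact hyz
  have h2 : dist (e Y) (e W) = dist (e Z) (e W) := by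
    rw [e.dist_eq, e.dist_eq]; exact hyv
  have key : e Y = e Z := by
    rw [Subtype.dist_eq, Subtype.dist_eq, Real.dist_eq, Real.dist_eq, abs_eq_abs] at h1 h2
    apply Subtype.ext
    rcases h1 with h1 | h1
    · linarith
    rcases h2 with h2 | h2
    · linarith
    have huw : e U = e W := Subtype.ext (by linarith)
    have huv : u = v := congrArg Subtype.val (e.injective huw)
    have hy' : dist u y + dist y v = dist u v := hy
    have hz' : dist u z + dist z v = dist u v := hz
    subst huv
    rw [dist_self, dist_comm y] at hy'
    rw [dist_self, dist_comm z] at hz'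
    have e1 : u = y := dist_eq_zero.1 (by linarith)
    have e2 : u = z := dist_eq_zero.1 (by linarith)
    have : Y = Z := Subtype.ext (e1.symm.trans e2)
    rw [this]
  exact congrArg Subtype.val (e.injective key)

theorem IsRealSegment.exists_injective_path {u v : X} (h : IsRealSegment (metricSegment u v))
    (huv : u ≠ v) :
    ∃ c : Path u v, Function.Injective c ∧ Set.range c ⊆ metricSegment u v := by
  obtain ⟨l, -, ⟨e⟩⟩ := h
  set a := e ⟨u, left_mem_metricSegment u v⟩ with ha
  set b := e ⟨v, right_mem_metricSegment u v⟩ with hb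
  have hab : (a : ℝ) ≠ b := fun h => huv (congrArg Subtype.val (e.injective (Subtype.ext h)))
  have hmem : ∀ t : unitInterval, AffineMap.lineMap (a : ℝ) (b : ℝ) (t : ℝ) ∈ Set.Icc (0 : ℝ) l :=
    fun t => (convex_Icc (0 : ℝ) l).lineMap_mem a.2 b.2 t.2
  let φ : unitInterval → X := fun t => (e.symm ⟨_, hmem t⟩ : metricSegment u v)
  have hφ : Continuous φ := by
    refine continuous_subtype_val.comp (e.symm.continuous.comp (Continuous.subtype_mk ?_ _))
    exact AffineMap.lineMap_continuous.comp continuous_subtype_val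
  refine ⟨⟨⟨φ, hφ⟩, ?_, ?_⟩, ?_, ?_⟩
  · change φ 0 = u
    simp [φ, ha]
  · change φ 1 = v
    simp [φ, hb]
  · intro s t hst
    have h1 := e.symm.injective (Subtype.ext hst)
    have h2 := congrArg Subtype.val h1
    exact Subtype.ext (AffineMap.lineMap_injective ℝ hab h2)
  · rintro _ ⟨t, rfl⟩
    exact (e.symm ⟨_, hmem t⟩).2

theorem Path.trans_injective {u v w : X} {c : Path u v} {c' : Path v w}
    (hc : Function.Injective c) (hc' : Function.Injective c')
    (h : Set.range c ∩ Set.range c' ⊆ {v}) : Function.Injective (c.trans c') := by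
  have mixed : ∀ s t : unitInterval, (s : ℝ) ≤ 1 / 2 → ¬ (t : ℝ) ≤ 1 / 2 →
      c.trans c' s ≠ c.trans c' t := by
    intro s t hs ht hst
    rw [Path.trans_apply, Path.trans_apply, dif_pos hs, dif_neg ht] at hst
    have hv := h ⟨⟨_, rfl⟩, ⟨_, hst.symm⟩⟩
    rw [Set.mem_singleton_iff, hst] at hv
    have := congrArg Subtype.val (hc' (hv.trans c'.source.symm))
    simp only [Set.Icc.coe_zero] at this
    apply ht
    linarith
  intro s t hst
  by_cases hs : (s : ℝ) ≤ 1 / 2 <;> by_cases ht : (t : ℝ) ≤ 1 / 2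
  · rw [Path.trans_apply, Path.trans_apply, dif_pos hs, dif_pos ht] at hst
    have := congrArg Subtype.val (hc hst)
    exact Subtype.ext (by simpa using this)
  · exact absurd hst (mixed s t hs ht)
  · exact absurd hst.symm (mixed t s ht hs)
  · rw [Path.trans_apply, Path.trans_apply, dif_neg hs, dif_neg ht] at hst
    have := congrArg Subtype.val (hc' hst)
    exact Subtype.ext (by simpa using this)

/-- Read in the segment, `c` is a continuous injective real function, hence strictly monotone, so `c
t` lies between the ends. -/
theorem Path.dist_add_dist_of_isRealSegment {u w : X} (c : Path u w) (hc : Function.Injective c)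
    (h : IsRealSegment (Set.range c)) (t : unitInterval) :
    dist u (c t) + dist (c t) w = dist u w := by
  obtain ⟨l, -, ⟨e⟩⟩ := h
  let g : unitInterval → ℝ := fun t => (e ⟨c t, t, rfl⟩ : Set.Icc (0 : ℝ) l)
  have hg : Continuous g :=
    continuous_subtype_val.comp (e.continuous.comp (c.continuous.subtype_mk _))
  have hinj : Function.Injective g := fun s t hst =>
    hc (congrArg Subtype.val (e.injective (Subtype.ext hst)))
  have hd : ∀ s t, dist (c s) (c t) = |g s - g t| := fun s t => by
    rw [← Real.dist_eq, ← Subtype.dist_eq, e.dist_eq, Subtype.dist_eq]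
  have h0 := hd 0 t
  have h1 := hd t 1
  have h2 := hd 0 1
  rw [c.source] at h0 h2
  rw [c.target] at h1 h2
  rw [h0, h1, h2]
  have hle0 : (0 : unitInterval) ≤ t := unitInterval.nonneg'
  have hle1 : t ≤ 1 := unitInterval.le_one'
  rcases hg.strictMono_of_inj_boundedOrder' hinj with hm | hm
  · have := hm.monotone hle0
    have := hm.monotone hle1
    rw [abs_of_nonpos, abs_of_nonpos, abs_of_nonpos] <;> linarith
  · have := hm.antitone hle0
    have := hm.antitone hle1
    rw [abs_of_nonneg, abs_of_nonneg, abs_of_nonneg] <;> linarith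

end Segments

/-! ### Comparison of the metric with the graph distance. -/

namespace SimplicialRealTree

variable {X : Type*} [MetricSpace X] (T : SimplicialRealTree X)

/-- A nontrivial combinatorial path is realised by an injective path in the union of its edges. -/
theorem exists_injective_path {u w : T.vertices} (p : T.graph.Walk u w) (hp : p.IsPath)
    (huw : u ≠ w) :
    ∃ c : Path (u : X) (w : X), Function.Injective c ∧ (∀ x ∈ Set.range c, ∃ a b : T.vertices,
      T.graph.Adj a b ∧ s(a, b) ∈ p.edges ∧ x ∈ metricSegment (a : X) b) ∧
      ∀ v ∈ p.support, (v : X) ∈ Set.range c := by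
  induction p with
  | nil => exact absurd rfl huw
  | cons h p ih =>
    rename_i u v w
    rw [SimpleGraph.Walk.cons_isPath_iff] at hp
    have huv : (u : X) ≠ v := fun h' => h.ne (Subtype.ext h')
    obtain ⟨c, hc, hcr⟩ := (T.edge_isRealSegment u v h).exists_injective_path huv
    by_cases hvw : v = w
    · subst hvw
      obtain rfl := (SimpleGraph.Walk.isPath_iff_nil.1 hp.1).eq_nil
      refine ⟨c, hc, fun x hx => ⟨u, v, h, by simp, hcr hx⟩, ?_⟩
      intro x hx
      simp only [SimpleGraph.Walk.support_cons, SimpleGraph.Walk.support_nil, List.mem_cons,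
        List.not_mem_nil, or_false] at hx
      rcases hx with rfl | rfl
      · exact ⟨0, c.source⟩
      · exact ⟨1, c.target⟩
    · obtain ⟨c', hc', hcr', hs'⟩ := ih hp.1 hvw
      refine ⟨c.trans c', Path.trans_injective hc hc' ?_, ?_, ?_⟩
      · rintro x ⟨hx, hx'⟩
        obtain ⟨a, b, hab, habp, hxab⟩ := hcr' x hx'
        have hxuv := hcr hx
        have hne : s(u, v) ≠ s(a, b) := fun he => by
          rw [← he] at habp
          exact hp.2 (p.fst_mem_support_of_mem_edges habp)
        -- A common point of the first edge and the rest is a vertex, so `u` or `v`; it is not `u`,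
        -- which the remaining path avoids.
        have hxv := T.mem_vertices_of_mem_edges u v a b h hab hne x hxuv hxab
        rcases T.vertex_of_mem_edge u v ⟨x, hxv⟩ h hxuv with h1 | h1
        · exfalso
          rcases T.vertex_of_mem_edge a b ⟨x, hxv⟩ hab hxab with h2 | h2
          · rw [← h2, h1] at habp
            exact hp.2 (p.fst_mem_support_of_mem_edges habp)
          · rw [← h2, h1] at habp
            exact hp.2 (p.snd_mem_support_of_mem_edges habp)
        · exact congrArg Subtype.val h1
      · intro x hx
        rw [Path.trans_range] at hx
        rcases hx with hx | hx
        · exact ⟨u, v, h, by simp, hcr hx⟩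
        · obtain ⟨a, b, hab, habp, hxab⟩ := hcr' x hx
          exact ⟨a, b, hab, by simp [habp], hxab⟩
      · intro x hx
        rw [Path.trans_range]
        rw [SimpleGraph.Walk.support_cons, List.mem_cons] at hx
        rcases hx with rfl | hx
        · exact Or.inl ⟨0, c.source⟩
        · exact Or.inr (hs' x hx)

/-- When all edges have length `L`, the distance between the ends of a combinatorial path is `L`
times its length. -/
theorem dist_eq_length_mul {L : ℝ} (hL : ∀ u v : T.vertices, T.graph.Adj u v → dist (u : X) v = L)
    {u w : T.vertices} (p : T.graph.Walk u w) (hp : p.IsPath) :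
    dist (u : X) w = p.length * L := by
  induction p with
  | nil => simp
  | cons h p ih =>
    rename_i u v w
    have huw : u ≠ w := by
      rintro rfl
      simpa using SimpleGraph.Walk.isPath_iff_nil.1 hp
    obtain ⟨c, hc, -, hs⟩ := T.exists_injective_path _ hp huw
    obtain ⟨t, ht⟩ := hs v (by simp)
    have := c.dist_add_dist_of_isRealSegment hc (T.injective_path c c.continuous hc) t
    rw [ht, hL u v h, ih ((SimpleGraph.Walk.cons_isPath_iff _ _).1 hp).1] at this
    rw [← this, SimpleGraph.Walk.length_cons]
    push_cast
    ring

theorem dist_eq_graph_dist_mul {L : ℝ}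
    (hL : ∀ u v : T.vertices, T.graph.Adj u v → dist (u : X) v = L) (u w : T.vertices) :
    dist (u : X) w = T.graph.dist u w * L := by
  obtain ⟨p, hp, hpl⟩ := T.isTree.1.exists_path_of_dist u w
  rw [T.dist_eq_length_mul hL p hp, hpl]

end SimplicialRealTree

/-! ### Vertex balls, discreteness and orbit counting. -/

namespace SimplicialRealTree

variable {X : Type*} [MetricSpace X] (T : SimplicialRealTree X)

variable {T} in
theorem IsBipartiteOfValences.finite_neighborSet {n₁ n₂ : ℕ} (h : T.IsBipartiteOfValences n₁ n₂)
    (v : T.vertices) : (T.graph.neighborSet v).Finite := by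
  obtain ⟨F, -, h1, h2⟩ := h
  by_cases hv : v ∈ F
  · exact Set.finite_of_encard_eq_coe (h1 v hv)
  · exact Set.finite_of_encard_eq_coe (h2 v hv)

variable {T} in
theorem IsBipartiteOfValences.two_le_encard {n₁ n₂ : ℕ} (h : T.IsBipartiteOfValences n₁ n₂)
    (hn₁ : 2 ≤ n₁) (hn₂ : 2 ≤ n₂) (v : T.vertices) : 2 ≤ (T.graph.neighborSet v).encard := by
  obtain ⟨F, -, h1, h2⟩ := h
  by_cases hv : v ∈ F
  · rw [h1 v hv]; exact_mod_cast hn₁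
  · rw [h2 v hv]; exact_mod_cast hn₂

variable {T} in
theorem IsBipartiteOfValences.three_le_encard {n₁ n₂ : ℕ} (h : T.IsBipartiteOfValences n₁ n₂)
    (hn₁ : 2 ≤ n₁) (hn₂ : 2 ≤ n₂) (hn : ¬ (n₁ = 2 ∧ n₂ = 2)) (u : T.vertices) :
    3 ≤ (T.graph.neighborSet u).encard ∨
      ∀ w, T.graph.Adj u w → 3 ≤ (T.graph.neighborSet w).encard := by
  obtain ⟨F, h0, h1, h2⟩ := h
  have hn' : 3 ≤ n₁ ∨ 3 ≤ n₂ := by omega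
  by_cases hu : u ∈ F
  · rcases hn' with h' | h'
    · left; rw [h1 u hu]; exact_mod_cast h'
    · right; intro w hw
      rw [h2 w ((h0 u w hw).1 hu)]; exact_mod_cast h'
  · rcases hn' with h' | h'
    · right; intro w hw
      rw [h1 w (by have := h0 u w hw; tauto)]; exact_mod_cast h'
    · left; rw [h2 u hu]; exact_mod_cast h'

/-- The set of vertices at distance at most `r` from `v`. -/
def vertexBall (v : X) (r : ℝ) : Set X := {x | x ∈ T.vertices ∧ dist v x ≤ r}

theorem vertexBall_eq_image {L : ℝ} (hL0 : 0 < L)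
    (hL : ∀ u v : T.vertices, T.graph.Adj u v → dist (u : X) v = L) (v : T.vertices) (n : ℕ) :
    T.vertexBall v (n * L) = Subtype.val '' {u | T.graph.dist v u ≤ n} := by
  have key : ∀ u : T.vertices, dist (v : X) u ≤ n * L ↔ T.graph.dist v u ≤ n := fun u => by
    rw [T.dist_eq_graph_dist_mul hL, mul_le_mul_iff_left₀ hL0, Nat.cast_le]
  ext x
  constructor
  · rintro ⟨hx, hd⟩
    exact ⟨⟨x, hx⟩, (key ⟨x, hx⟩).1 hd, rfl⟩
  · rintro ⟨u, hu, rfl⟩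
    exact ⟨u.2, (key u).2 hu⟩

theorem finite_vertexBall {L : ℝ} (hL0 : 0 < L)
    (hL : ∀ u v : T.vertices, T.graph.Adj u v → dist (u : X) v = L)
    (hf : ∀ v, (T.graph.neighborSet v).Finite) (v : T.vertices) (r : ℝ) :
    (T.vertexBall v r).Finite := by
  obtain ⟨n, hn⟩ := exists_nat_ge (r / L)
  rw [div_le_iff₀ hL0] at hn
  have h : (T.vertexBall v (n * L)).Finite := by
    rw [T.vertexBall_eq_image hL0 hL]
    exact (T.isTree.1.finite_dist_le hf v n).image _
  exact h.subset fun x hx => ⟨hx.1, hx.2.trans hn⟩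

variable {T}

theorem isom_dist_smul (g : T.isom) (x y : X) : dist (g • x) (g • y) = dist x y :=
  (g : X ≃ᵢ X).dist_eq x y

theorem isom_smul_mem_vertices (g : T.isom) {x : X} (hx : x ∈ T.vertices) : g • x ∈ T.vertices :=
  (g.2.1 x).2 hx

/-- An isometry fixing all the vertices of a large ball fixes a given bounded set pointwise. -/
theorem smul_eq_self_of_forall_vertexBall {L : ℝ}
    (hL : ∀ u v : T.vertices, T.graph.Adj u v → dist (u : X) v = L) {v : X} {r : ℝ} (hL0 : 0 < L)
    (g : T.isom) (hg : ∀ x ∈ T.vertexBall v (r + L), g • x = x) {x : X} (hx : dist v x ≤ r) :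
    g • x = x := by
  rcases T.cover x with hxv | ⟨a, b, hab, hxab⟩
  · exact hg x ⟨hxv, by linarith⟩
  · have hd : dist (a : X) x + dist x b = dist (a : X) b := hxab
    rw [hL a b hab] at hd
    have h1 := dist_triangle v x a
    have h2 := dist_triangle v x b
    rw [dist_comm x (a : X)] at h1
    -- The ends of the edge through `x` are within `L` of `x`, hence the radius `r + L`.
    have ha := hg a ⟨a.2, by linarith [dist_nonneg (x := x) (y := (b : X))]⟩
    have hb := hg b ⟨b.2, by linarith [dist_nonneg (x := (a : X)) (y := x)]⟩
    have hga : dist (a : X) (g • x) = dist (a : X) x := by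
      conv_lhs => rw [← ha]
      exact isom_dist_smul g _ _
    have hgb : dist (g • x) (b : X) = dist x b := by
      conv_lhs => rw [← hb]
      exact isom_dist_smul g _ _
    refine (T.edge_isRealSegment a b hab).eq_of_dist_eq ?_ hxab hga
    change dist (a : X) (g • x) + dist (g • x) (b : X) = dist (a : X) b
    rw [hga, hgb]
    exact hxab

theorem exists_compact_of_discrete (H : Subgroup T.isom) (hH : DiscreteTopology H) :
    ∃ K : Set X, IsCompact K ∧ ∀ g ∈ H, (∀ x ∈ K, g • x = x) → g = 1 := by
  have h1 : ({1} : Set H) ∈ nhds (1 : H) := by rw [nhds_discrete]; exact Set.mem_singleton _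
  rw [nhds_subtype, Filter.mem_comap] at h1
  obtain ⟨U, hU, hUH⟩ := h1
  obtain ⟨_, ⟨K, hK, rfl⟩, hKU⟩ := (T.isomBasis.nhds_one_hasBasis.mem_iff).1 hU
  refine ⟨K, hK, fun g hg hgK => ?_⟩
  have : (⟨g, hg⟩ : H) ∈ ({1} : Set H) := hUH (hKU hgK)
  exact congrArg Subtype.val this

theorem exists_vertexBall_of_discrete {L : ℝ} (hL0 : 0 < L)
    (hL : ∀ u v : T.vertices, T.graph.Adj u v → dist (u : X) v = L) (v : X)
    (H : Subgroup T.isom) (hH : DiscreteTopology H) :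
    ∃ r : ℝ, ∀ g ∈ H, (∀ x ∈ T.vertexBall v r, g • x = x) → g = 1 := by
  obtain ⟨K, hK, h⟩ := exists_compact_of_discrete H hH
  obtain ⟨r, hr⟩ := hK.isBounded.subset_closedBall v
  refine ⟨r + L, fun g hg hgx => h g hg fun x hx => ?_⟩
  refine smul_eq_self_of_forall_vertexBall hL hL0 g hgx ?_
  rw [dist_comm]
  exact hr hx

section Counting

variable {Γ : Type*} [Group Γ] (ρ : Γ →* T.isom)

/-- The stabiliser acts on every ball around `v`. By discreteness and injectivity this action is
faithful on some ball, which is finite. -/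
theorem finite_stabilizer_of_discrete {L : ℝ} (hL0 : 0 < L)
    (hL : ∀ u v : T.vertices, T.graph.Adj u v → dist (u : X) v = L)
    (hf : ∀ v, (T.graph.neighborSet v).Finite) (v : T.vertices)
    (hinj : Function.Injective ρ) (hd : DiscreteTopology ρ.range) :
    {γ : Γ | ρ γ • (v : X) = v}.Finite := by
  obtain ⟨r, hr⟩ := exists_vertexBall_of_discrete hL0 hL v ρ.range hd
  have := (T.finite_vertexBall hL0 hL hf v r).to_subtype
  let W := T.vertexBall (v : X) r
  let F : {γ : Γ | ρ γ • (v : X) = v} → W → W := fun γ x => ⟨ρ γ • (x : X),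
    isom_smul_mem_vertices _ x.2.1, by
      have h := isom_dist_smul (ρ γ) (v : X) (x : X)
      rw [γ.2] at h
      exact h.trans_le x.2.2⟩
  have hF : Function.Injective F := by
    intro γ γ' h
    apply Subtype.ext
    rw [← inv_mul_eq_one]
    apply hinj
    rw [map_one]
    refine hr _ ⟨_, rfl⟩ fun x hx => ?_
    have h' : ρ γ • x = ρ γ' • x := congrArg Subtype.val (congrFun h ⟨x, hx⟩)
    rw [map_mul, map_inv, mul_smul, ← h', inv_smul_smul]
  have : Finite {γ : Γ | ρ γ • (v : X) = v} := Finite.of_injective F hF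
  exact Set.toFinite _

theorem ncard_dist_smul_le {v : X} (hv : v ∈ T.vertices)
    (hS : {γ : Γ | ρ γ • v = v}.Finite) {r : ℝ} (hB : (T.vertexBall v r).Finite) :
    {γ : Γ | dist v (ρ γ • v) ≤ r}.Finite ∧
      {γ : Γ | dist v (ρ γ • v) ≤ r}.ncard ≤
        (T.vertexBall v r).ncard * {γ : Γ | ρ γ • v = v}.ncard := by
  -- A section of the orbit map, with default value `1` off the orbit; it splits `γ` into an orbit
  -- point and a stabiliser element.
  have hex : ∀ x : X, ∃ δ : Γ, (∃ γ, ρ γ • v = x) → ρ δ • v = x := fun x => by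
    by_cases h : ∃ γ, ρ γ • v = x
    · exact ⟨h.choose, fun _ => h.choose_spec⟩
    · exact ⟨1, fun h' => absurd h' h⟩
  choose s hs using hex
  let f : Γ → X × Γ := fun γ => (ρ γ • v, (s (ρ γ • v))⁻¹ * γ)
  have hmaps : ∀ γ ∈ {γ : Γ | dist v (ρ γ • v) ≤ r},
      f γ ∈ T.vertexBall v r ×ˢ {γ : Γ | ρ γ • v = v} := fun γ hγ => by
    refine ⟨⟨isom_smul_mem_vertices _ hv, hγ⟩, ?_⟩
    change ρ ((s (ρ γ • v))⁻¹ * γ) • v = v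
    rw [map_mul, map_inv, mul_smul, inv_smul_eq_iff, hs _ ⟨γ, rfl⟩]
  have hinj : Function.Injective f := fun γ γ' h => by
    have h1 : ρ γ • v = ρ γ' • v := congrArg Prod.fst h
    have h2 : (s (ρ γ • v))⁻¹ * γ = (s (ρ γ' • v))⁻¹ * γ' := congrArg Prod.snd h
    rw [h1] at h2
    exact mul_left_cancel h2
  have hfin := hB.prod hS
  refine ⟨Set.Finite.of_injOn (f := f) hmaps hinj.injOn hfin, ?_⟩
  rw [← Set.ncard_prod]
  exact Set.ncard_le_ncard_of_injOn f hmaps hinj.injOn hfin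

end Counting

/-- If `Γ` has finitely many orbits of vertices, its orbits are at least as large as the balls, up
to a multiplicative and an additive constant. -/
theorem FiniteQuotient.exists_ncard_vertexBall_le {Γ : Subgroup T.isom} (h : T.FiniteQuotient Γ)
    (v : X) : ∃ (m : ℕ) (M : ℝ), ∀ r : ℝ,
      {γ : Γ | dist v ((γ : T.isom) • v) ≤ r + M}.Finite →
      (T.vertexBall v r).ncard ≤ {γ : Γ | dist v ((γ : T.isom) • v) ≤ r + M}.ncard * m := by
  -- `F` has one vertex per orbit, and `M` bounds the distances from `v` to `F`.
  obtain ⟨F, hFsub, hFbij⟩ := Set.exists_subset_bijOn T.vertices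
    (fun x : X => MulAction.orbit Γ x)
  have hF : F.Finite := Set.Finite.of_finite_image (hFbij.image_eq ▸ h.1) hFbij.injOn
  obtain ⟨M, hM⟩ := (hF.image fun x => dist v x).bddAbove
  refine ⟨F.ncard, M, fun r hfin => ?_⟩
  rw [← Set.ncard_prod]
  have hsub : T.vertexBall v r ⊆ (fun p : Γ × X => p.1 • p.2) ''
      ({γ : Γ | dist v ((γ : T.isom) • v) ≤ r + M} ×ˢ F) := by
    rintro x ⟨hx, hd⟩
    obtain ⟨y, hy, hxy⟩ := hFbij.surjOn ⟨x, hx, rfl⟩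
    obtain ⟨γ, rfl⟩ : x ∈ MulAction.orbit Γ y := by
      rw [show MulAction.orbit Γ y = MulAction.orbit Γ x from hxy]
      exact MulAction.mem_orbit_self x
    refine ⟨(γ, y), ⟨?_, hy⟩, rfl⟩
    have h1 := hM ⟨y, hy, rfl⟩
    have h2 : dist ((γ : T.isom) • y) ((γ : T.isom) • v) = dist y v := isom_dist_smul _ _ _
    have h3 := dist_triangle v ((γ : T.isom) • y) ((γ : T.isom) • v)
    have h4 : dist v ((γ : T.isom) • y) ≤ r := hd
    rw [h2, dist_comm y v] at h3
    change dist v ((γ : T.isom) • v) ≤ r + M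
    simp only at h1
    linarith
  exact (Set.ncard_le_ncard hsub ((hfin.prod hF).image _)).trans
    (Set.ncard_image_le (hfin.prod hF))

/-- Moving both base points to `v` costs twice each displacement, which is added to `R` beforehand.
-/
theorem Admissible.exists_finite {Γ : Subgroup T.isom} {ρ : Γ →* T.isom} {x₀ x₀' : X}
    (h : T.Admissible T Γ x₀ x₀' ρ) (v : X) {R : ℝ} (hR : 0 < R) :
    {γ : Γ | ¬ dist v (ρ γ • v) ≤ dist v ((γ : T.isom) • v) - R}.Finite := by
  have h' := h (R + 2 * dist v x₀ + 2 * dist v x₀') (by positivity)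
  rw [Filter.eventually_cofinite] at h'
  refine h'.subset fun γ hγ hle => hγ ?_
  have h1 := isom_dist_smul (ρ γ) x₀' v
  have h2 := isom_dist_smul (γ : T.isom) v x₀
  have h3 := dist_triangle4 v x₀' (ρ γ • x₀') (ρ γ • v)
  have h4 := dist_triangle4 x₀ v ((γ : T.isom) • v) ((γ : T.isom) • x₀)
  rw [h1, dist_comm x₀' v] at h3
  rw [h2, dist_comm x₀ v] at h4
  linarith

end SimplicialRealTree

/-! ### The growth contradiction. -/

theorem mainTheorem9 {X : Type*} [MetricSpace X] (T : SimplicialRealTree X)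
    (n₁ n₂ : ℕ) (hn₁ : 2 ≤ n₁) (hn₂ : 2 ≤ n₂) (hn : ¬ (n₁ = 2 ∧ n₂ = 2))
    (hval : T.IsBipartiteOfValences n₁ n₂) (hlen : T.EdgesOfEqualLength)
    (Γ₀ : Subgroup T.isom) (hdisc : DiscreteTopology Γ₀)
    (htf : ∀ γ ∈ Γ₀, γ ≠ 1 → ¬ IsOfFinOrder γ)
    (hfin : T.FiniteQuotient Γ₀) (x₀ x₀' : X) :
    ¬ ∃ ρ : Γ₀ →* T.isom,
      T.Admissible T Γ₀ x₀ x₀' ρ ∧ Function.Injective ρ ∧ DiscreteTopology ρ.range := by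
  rintro ⟨ρ, hadm, hinj, hd⟩
  obtain ⟨L, hL⟩ := hlen
  have hf := hval.finite_neighborSet
  have h2 := hval.two_le_encard hn₁ hn₂
  obtain ⟨v⟩ := T.isTree.1.nonempty
  have hL0 : 0 < L := by
    obtain ⟨w, hw, -⟩ := T.isTree.children_nonempty (r := v) (h2 v)
    rw [← hL v w hw]
    exact dist_pos.2 fun h => hw.ne (Subtype.ext h)
  have hB := T.finite_vertexBall hL0 hL hf v
  set b : ℕ → ℕ := fun n => (T.vertexBall (v : X) (n * L)).ncard with hb
  have hdouble : ∀ n, 2 * b n ≤ b (n + 2) := fun n => by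
    simp only [hb]
    rw [T.vertexBall_eq_image hL0 hL, T.vertexBall_eq_image hL0 hL,
      Set.ncard_image_of_injective _ Subtype.val_injective,
      Set.ncard_image_of_injective _ Subtype.val_injective]
    exact T.isTree.two_mul_ncard_ball_le hf h2 (hval.three_le_encard hn₁ hn₂ hn) v n
  have hgrow : ∀ k n, 2 ^ k * b n ≤ b (n + 2 * k) := by
    intro k n
    induction k with
    | zero => simp
    | succ k ih =>
      have := hdouble (n + 2 * k)
      rw [pow_succ', mul_assoc, show n + 2 * (k + 1) = n + 2 * k + 2 by ring]
      omega
  have hb0 : 1 ≤ b 0 :=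
    (Set.ncard_pos (hB _)).2 ⟨v, v.2, by simp⟩
  have hS := SimplicialRealTree.finite_stabilizer_of_discrete ρ hL0 hL hf v hinj hd
  obtain ⟨m, M, hM⟩ := hfin.exists_ncard_vertexBall_le (v : X)
  set C := {γ : Γ₀ | ρ γ • (v : X) = v}.ncard
  obtain ⟨k, hk⟩ : ∃ k : ℕ, C * m + 1 ≤ 2 ^ k := ⟨_, Nat.lt_two_pow_self.le⟩
  -- `2 * k * L` lowers the radius from `(n + 2k) * L` to `n * L`, `|M|` absorbs `M`, and `1`
  -- ensures positivity.
  have hE := hadm.exists_finite (v : X) (R := 2 * k * L + |M| + 1) (by positivity)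
  set E := {γ : Γ₀ | ¬ dist (v : X) (ρ γ • (v : X)) ≤
    dist (v : X) ((γ : T.isom) • (v : X)) - (2 * k * L + |M| + 1)}
  have hbound : ∀ n, b n ≤ E.ncard * m := by
    intro n
    obtain ⟨hA, hAle⟩ := SimplicialRealTree.ncard_dist_smul_le ρ v.2 hS (hB (n * L))
    have hsub : {γ : Γ₀ | dist (v : X) ((γ : T.isom) • (v : X)) ≤ (n + 2 * k : ℕ) * L + M} ⊆
        E ∪ {γ : Γ₀ | dist (v : X) (ρ γ • (v : X)) ≤ n * L} := by
      intro γ hγ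
      by_cases h : γ ∈ E
      · exact Or.inl h
      · right
        have h1 := not_not.1 h
        have h3 : dist (v : X) ((γ : T.isom) • (v : X)) ≤ (n + 2 * k : ℕ) * L + M := hγ
        push_cast at h3
        change dist (v : X) (ρ γ • (v : X)) ≤ n * L
        linarith [le_abs_self M]
    have h1 := hM _ ((hE.union hA).subset hsub)
    have h3 := (Set.ncard_le_ncard hsub (hE.union hA)).trans (Set.ncard_union_le _ _)
    have h4 : b (n + 2 * k) ≤ (E.ncard + b n * C) * m :=
      h1.trans (Nat.mul_le_mul_right m (h3.trans (Nat.add_le_add_left hAle _)))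
    have h5 := (Nat.mul_le_mul_right (b n) hk).trans ((hgrow k n).trans h4)
    -- The terms `C * m * b n` cancel in `(C * m + 1) * b n ≤ (|E| + b n * C) * m`.
    nlinarith
  -- Using the bound itself as exponent gives `2 ^ (|E| * m) ≤ |E| * m`.
  have h1 := hgrow (E.ncard * m) 0
  have h3 := hbound (0 + 2 * (E.ncard * m))
  have h4 : E.ncard * m < 2 ^ (E.ncard * m) := Nat.lt_two_pow_self
  nlinarith
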